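/- Discs on the Riemann sphere $\mathbb P=\mathbb C\cup\{\infty\}$ are the Möbius images of the closed unit disc; two of them are tangent if their bounding circles meet in exactly one point and their interiors are disjoint. An $n$-flower consists of a disc $C$ (the center) and discs $c_j$, $j\in\mathbb Z/n$ (the petals), such that every $c_j$ is tangent to $C$ and to $c_{j+1}$. It is un-branched if the petals wrap exactly once (counterclockwise) around $C$: after a Möbius transformation taking $C$ to the unit disc, $c_j$ touches $C$ at $e^{i\theta_j}$ with $\theta_0<\theta_1<\dots<\theta_{n-1}<\theta_0+2\pi$. It is univalent if it is un-branched and its petals have mutually disjoint interiors. Let $V,W,A,B$ be the discs of radius $\sqrt3$ with centers $1-\sqrt3\,i,\ 1+\sqrt3\,i,\ -2,\ 4$. If $v,w,a$ and $v,w,b$ are two triples of mutually tangent discs, let $m_f$, $m_g$ be the Möbius transformations taking $(V,W,A)$ to $(v,w,a)$ and $(V,W,B)$ to $(v,w,b)$, respectively. The intrinsic schwarzian of the patch $\{v,w\,|\,a,b\}$ is the real number $s$ for which $m_g^{-1}\circ m_f$ is given by the matrix $\begin{pmatrix}1+s&-s\\ s&1-s\end{pmatrix}$. The label of an $n$-flower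 is $p=(u_0,\dots,u_{n-1})$, where $u_j=1-s_j$ and $s_j$ is the intrinsic schwarzian of the patch $\{c_j,C\,|\,c_{j-1},c_{j+1}\}$. The normalized layout for a label is the flower with that label for which $C$ is the upper half plane, $c_0$ is the half plane $\{x+iy: y\le -2\}$, and $c_1$ is the disc of radius $1$ tangent to $C$ at $0$. Theorem. Let $n>3$ and let $p=(u_0,\dots,u_{n-1})$ be the label of an un-branched $n$-flower. The flower is univalent if and only if the following two conditions hold. (A) $\frac1{\sqrt3}\le u_j\le\frac{n-2}{\sqrt3}$ for all $j=0,\dots,n-1$. (B) For every $k=0,\dots,n-1$ and every $j=2,\dots,n-2$, the petal $c_j$ in the normalized layout for the cyclically shifted label $(u_k,u_{k+1},\dots,u_{k+n-1})$ (indices modulo $n$) is a Euclidean disc of radius at most $1$. -/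

import Mathlib

open scoped Pointwise MatrixGroups

noncomputable section

namespace CirclePacking

/-- The Riemann sphere `ℂ ∪ {∞}`, with the topology of the one-point compactification and with
the action of `GL(2, ℂ)` by Möbius transformations. -/
abbrev Sphere : Type := OnePoint ℂ

/-- The closed Euclidean disc with centre `z` and radius `r`, as a subset of the sphere. -/
def euclDisc (z : ℂ) (r : ℝ) : Set Sphere :=
  (fun w : ℂ => (w : Sphere)) '' Metric.closedBall z r

/-- The set `H` of complex numbers (in use: a closed half plane), completed by the point `∞`. -/
def withInfty (H : Set ℂ) : Set Sphere :=
  insert OnePoint.infty ((fun w : ℂ => (w : Sphere)) '' H)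

/-- A circle of the sphere together with a choice of interior, encoded by the closed disc that it
bounds: a Möbius image of the closed unit disc. It may be a Euclidean disc, a half plane, or the
exterior of a Euclidean circle. The circle itself is the frontier of the disc. -/
def IsDisc (D : Set Sphere) : Prop :=
  ∃ g : GL (Fin 2) ℂ, D = g • euclDisc 0 1

/-- `D` and `E` are (externally) tangent at `t`: the circles intersect in the single point `t` and
their interiors are disjoint. -/
def TangentAt (D E : Set Sphere) (t : Sphere) : Prop :=
  frontier D ∩ frontier E = {t} ∧ Disjoint (interior D) (interior E)

/-- External tangency of two circles. -/
def Tangent (D E : Set Sphere) : Prop :=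
  ∃ t, TangentAt D E t

/-! ### Intrinsic schwarzians -/

/-- The base patch: four circles of radius `√3`. The discs `baseV`, `baseW`, `baseA` form an
equilateral face symmetric about the origin, `baseV` and `baseW` touch at `1`, the edge from the
centre of `baseV` to the centre of `baseW` has that face on its left, and `baseV`, `baseW`, `baseB`
form the contiguous equilateral face. -/
def baseV : Set Sphere := euclDisc ⟨1, -Real.sqrt 3⟩ (Real.sqrt 3)

/-- See `baseV`. -/
def baseW : Set Sphere := euclDisc ⟨1, Real.sqrt 3⟩ (Real.sqrt 3)

/-- See `baseV`. -/
def baseA : Set Sphere := euclDisc (-2) (Real.sqrt 3)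

/-- See `baseV`. -/
def baseB : Set Sphere := euclDisc 4 (Real.sqrt 3)

/-- The parabolic Möbius transformation `M_s`, fixing the point `1`. -/
def parabolicM (s : ℝ) : GL (Fin 2) ℂ :=
  Matrix.GeneralLinearGroup.mkOfDetNeZero !![1 + (s : ℂ), -(s : ℂ); (s : ℂ), 1 - (s : ℂ)] (by
    have h : Matrix.det !![1 + (s : ℂ), -(s : ℂ); (s : ℂ), 1 - (s : ℂ)] = 1 := by
      rw [Matrix.det_fin_two_of]; ring
    rw [h]; exact one_ne_zero)

/-- `s` is the intrinsic schwarzian of the patch `{v, w | a, b}`, that is, of the shared edge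
`(v, w)` of the faces `f = {v, w, a}` and `g = {w, v, b}`: if the Möbius transformations `mf`, `mg`
take the two base faces to `f` and `g`, then `mg⁻¹ ∘ mf = M_s` (for suitably scaled matrices). -/
def IsSchwarzian (v w a b : Set Sphere) (s : ℝ) : Prop :=
  ∃ mf mg : GL (Fin 2) ℂ,
    (mf • baseV = v ∧ mf • baseW = w ∧ mf • baseA = a) ∧
    (mg • baseV = v ∧ mg • baseW = w ∧ mg • baseB = b) ∧
    mg⁻¹ * mf = parabolicM s

/-! ### Flowers -/

/-- A closed `n`-flower `{C; c_0, …, c_{n-1}}` on the sphere, with indices modulo `n`: every petal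
is tangent to the central circle, and successive petals are tangent. -/
@[ext]
structure Flower (n : ℕ) where
  center : Set Sphere
  petal : ZMod n → Set Sphere
  isDisc_center : IsDisc center
  isDisc_petal : ∀ j, IsDisc (petal j)
  tangent_center : ∀ j, Tangent center (petal j)
  tangent_succ : ∀ j, Tangent (petal j) (petal (j + 1))

namespace Flower

variable {n : ℕ}

/-- The petals wrap (counterclockwise) `d` times around the center. After the center has been moved
to the unit disc, the petals touch it at points `exp (i θ_j)`, where the arguments increase by less
than a full turn from each petal to the next one, and by `2 π d` in total. -/
def WrapsTimes (F : Flower n) (d : ℕ) : Prop :=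
  ∃ g : GL (Fin 2) ℂ, g • F.center = euclDisc 0 1 ∧
    ∃ θ : ℕ → ℝ,
      (∀ j, θ j < θ (j + 1) ∧ θ (j + 1) < θ j + 2 * Real.pi) ∧
      (∀ j, θ (j + n) = θ j + 2 * Real.pi * d) ∧
      ∀ j : ℕ, TangentAt (g • F.center) (g • F.petal (j : ZMod n))
        ((Complex.exp (Complex.I * (θ j : ℂ)) : ℂ) : Sphere)

/-- The petals wrap exactly once around the center. -/
def Unbranched (F : Flower n) : Prop :=
  F.WrapsTimes 1

/-- The flower is un-branched and its petals have mutually disjoint interiors. -/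
def Univalent (F : Flower n) : Prop :=
  F.Unbranched ∧ ∀ i j : ZMod n, i ≠ j → Disjoint (interior (F.petal i)) (interior (F.petal j))

/-- `u` is the label of the flower in terms of the variables `u_j = 1 - s_j`, where `s_j` is the
intrinsic schwarzian of the edge from the center to the petal `c_j`, i.e. of the patch
`{c_j, C | c_{j-1}, c_{j+1}}`. -/
def HasLabel (F : Flower n) (u : ZMod n → ℝ) : Prop :=
  ∀ j, IsSchwarzian (F.petal j) F.center (F.petal (j - 1)) (F.petal (j + 1)) (1 - u j)

/-- The flower is in normalized position: `C` is the upper half plane, `c_0` is the half plane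
`{y ≤ -2}`, and `c_1` is the disc of radius `1` tangent to `C` at `0`. -/
def IsNormalized (F : Flower n) : Prop :=
  F.center = withInfty {z | 0 ≤ z.im} ∧
  F.petal 0 = withInfty {z | z.im ≤ -2} ∧
  F.petal 1 = euclDisc (-Complex.I) 1

end Flower

/-! ### Labels -/

/-- The cyclic shift of a label under which the coordinate `u_k` becomes `u_0`. -/
def shift {n : ℕ} (k : ZMod n) (p : ZMod n → ℝ) : ZMod n → ℝ :=
  fun j => p (j + k)

/-- In the normalized layout for the label `p`, the petal `c_j` is a Euclidean disc of
radius `r`. -/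
def IsLayoutRadius {n : ℕ} (p : ZMod n → ℝ) (j : ZMod n) (r : ℝ) : Prop :=
  ∃ G : Flower n, G.IsNormalized ∧ G.HasLabel p ∧ 0 < r ∧ ∃ z : ℂ, G.petal j = euclDisc z r

/-- Condition (A): `1/√3 ≤ u_j ≤ (n-2)/√3` for all `j`. -/
def ConditionA {n : ℕ} (p : ZMod n → ℝ) : Prop :=
  ∀ j, 1 / Real.sqrt 3 ≤ p j ∧ p j ≤ ((n : ℝ) - 2) / Real.sqrt 3

/-- Condition (B): in the normalized layouts of all the cyclic shifts of `p`, the petals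
`c_2, …, c_{n-2}` have radius at most `1`. -/
def ConditionB {n : ℕ} (p : ZMod n → ℝ) : Prop :=
  ∀ k : ZMod n, ∀ j : ℕ, 2 ≤ j → j ≤ n - 2 →
    ∃ r : ℝ, IsLayoutRadius (shift k p) (j : ZMod n) r ∧ r ≤ 1

end CirclePacking

end

open scoped Pointwise MatrixGroups

noncomputable section

namespace CirclePacking

/-! Univalence is tested one petal at a time in normalized position. Renumber the petals so that a
given petal becomes `c_0`, then move `C` to the half plane y ≥ 0, `c_0` to y ≤ -2 and `c_1` to the
unit disc about -i. Every other petal touches y ≥ 0 from outside, so its interior misses that of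
`c_0` exactly when it lies in the strip -2 ≤ y ≤ 0, that is, when it is a Euclidean disc of radius
at most 1 (`IsDisc.exists_euclDisc`, `disjoint_interior_lowerDisc`). Neighbouring petals have
disjoint interiors by tangency, so (B), read over all shifts, is disjointness of the remaining
pairs.

The layout in (B) must be the flower's own. A Möbius map preserving three mutually tangent discs
fixes their three tangency points and is the identity, so a schwarzian determines each petal from
the two before it (`IsSchwarzian.eq_of_eq`, `IsNormalized.petal_eq`).

For (A), the last petal is the unit disc about 2√3 u_0 - i (`IsNormalized.petal_neg_one`), and u_0 >
0 because the petals run counterclockwise once around (`Unbranched.label_pos`). Disjointness from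
`c_1` forces 2√3 u_0 ≥ 2. The chain from `c_1` to `c_{n-1}` consists of touching discs of diameter
at most 2, so 2√3 u_0 ≤ 2(n-2).

Discs are handled as negative sets of indefinite Hermitian forms, on which Möbius maps act by
congruence (`smul_mem_hset`). -/

/-! ### The Möbius action -/

/-- The inversion `z ↦ 1 / z` of the sphere. -/
def sphereInv (x : Sphere) : Sphere :=
  x.elim ((0 : ℂ) : Sphere) (fun z => if z = 0 then OnePoint.infty else ((z⁻¹ : ℂ) : Sphere))

open Filter Topology in
lemma continuous_sphereInv : Continuous sphereInv := by
  have hco : Tendsto (fun z : ℂ => (z : Sphere)) (Bornology.cobounded ℂ) (𝓝 OnePoint.infty) := by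
    rw [Metric.cobounded_eq_cocompact, ← coclosedCompact_eq_cocompact]
    exact OnePoint.tendsto_coe_infty
  have hne : ∀ {l : Filter ℂ}, l ≤ 𝓟 {0}ᶜ →
      (fun z : ℂ => ((z⁻¹ : ℂ) : Sphere)) =ᶠ[l] fun z => sphereInv z := by
    intro l hl
    filter_upwards [hl (mem_principal_self _)] with z hz
    exact (if_neg hz).symm
  refine (OnePoint.continuous_iff _).2 ⟨?_, continuous_iff_continuousAt.2 fun z => ?_⟩
  · rw [coclosedCompact_eq_cocompact, ← Metric.cobounded_eq_cocompact]
    refine Tendsto.congr' (hne ?_) ((OnePoint.continuous_coe.tendsto 0).comp tendsto_inv₀_cobounded)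
    rw [le_principal_iff]
    exact (Bornology.isBounded_singleton (x := (0 : ℂ)))
  · by_cases hz : z = 0
    · subst hz
      rw [← continuousWithinAt_compl_self]
      have h0 : sphereInv ((0 : ℂ) : Sphere) = OnePoint.infty := if_pos rfl
      rw [ContinuousWithinAt, h0]
      exact Tendsto.congr' (hne inf_le_right) (hco.comp tendsto_inv₀_nhdsNE_zero)
    · have h1 : ContinuousAt (fun w : ℂ => ((w⁻¹ : ℂ) : Sphere)) z :=
        OnePoint.continuous_coe.continuousAt.comp (continuousAt_inv₀ hz)
      refine h1.congr (hne ?_)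
      rw [le_principal_iff]
      exact isOpen_compl_singleton.mem_nhds hz

lemma continuous_affine {k : ℂ} (hk : k ≠ 0) (l : ℂ) :
    Continuous (OnePoint.map (fun z : ℂ => k * z + l)) := by
  refine OnePoint.continuous_map (by fun_prop) ?_
  rw [Filter.coclosedCompact_eq_cocompact]
  exact (((Homeomorph.mulLeft₀ k hk).trans (Homeomorph.addRight l)).isClosedEmbedding).tendsto_cocompact

/-- Lets Möbius maps commute with closure, interior and frontier. When c ≠ 0, (az+b)/(cz+d) = a/c +
(b - ad/c)/(cz+d) is affine after inversion after affine. -/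
instance : ContinuousConstSMul (GL (Fin 2) ℂ) Sphere where
  continuous_const_smul g := by
    have hdet : g 0 0 * g 1 1 - g 0 1 * g 1 0 ≠ 0 := by
      have := g.det_ne_zero
      rwa [Matrix.det_fin_two] at this
    by_cases hc : g 1 0 = 0
    · have hd : g 1 1 ≠ 0 := by rintro h; simp [h, hc] at hdet
      have ha : g 0 0 ≠ 0 := by rintro h; simp [h, hc] at hdet
      convert continuous_affine (div_ne_zero ha hd) (g 0 1 / g 1 1) using 1
      ext1 x
      induction x using OnePoint.rec with
      | infty => simp [OnePoint.smul_infty_eq_ite, hc]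
      | coe z =>
        simp only [OnePoint.smul_some_eq_ite, hc, zero_mul, zero_add, if_neg hd, OnePoint.map_some]
        congr 1
        field_simp
    · have hk : g 0 1 - g 0 0 * g 1 1 / g 1 0 ≠ 0 := by
        intro h
        apply hdet
        field_simp at h
        linear_combination -h
      convert (continuous_affine hk (g 0 0 / g 1 0)).comp
        (continuous_sphereInv.comp (continuous_affine hc (g 1 1))) using 1
      ext1 x
      induction x using OnePoint.rec with
      | infty => simp [OnePoint.smul_infty_eq_ite, hc, sphereInv]
      | coe z =>
        simp only [OnePoint.smul_some_eq_ite, Function.comp, OnePoint.map_some, sphereInv,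
          OnePoint.elim_some]
        split_ifs with h
        · simp
        · simp only [OnePoint.map_some]
          congr 1
          rw [div_eq_iff h, add_mul, mul_assoc, inv_mul_cancel₀ h]
          field_simp
          ring

/-! ### Hermitian forms -/

/-- The Hermitian form with matrix entries `α`, `β`, `γ`. -/
def hform (α : ℝ) (β : ℂ) (γ : ℝ) (z w : ℂ) : ℝ :=
  α * Complex.normSq z + 2 * (β * z * star w).re + γ * Complex.normSq w

/-- The points of the sphere where a Hermitian form is nonpositive. -/
def hset (α : ℝ) (β : ℂ) (γ : ℝ) : Set Sphere :=
  {x | x.elim (α ≤ 0) (fun z => hform α β γ z 1 ≤ 0)}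

@[simp] lemma infty_mem_hset {α : ℝ} {β : ℂ} {γ : ℝ} :
    OnePoint.infty ∈ hset α β γ ↔ α ≤ 0 := Iff.rfl

@[simp] lemma coe_mem_hset {α : ℝ} {β : ℂ} {γ : ℝ} {z : ℂ} :
    (z : Sphere) ∈ hset α β γ ↔ hform α β γ z 1 ≤ 0 := Iff.rfl

lemma hform_smul (α : ℝ) (β : ℂ) (γ : ℝ) (t z w : ℂ) :
    hform α β γ (t * z) (t * w) = Complex.normSq t * hform α β γ z w := by
  simp only [hform, Complex.normSq_apply, Complex.star_def, Complex.mul_re, Complex.mul_im,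
    Complex.conj_re, Complex.conj_im]
  ring

lemma hform_scale (t α : ℝ) (β : ℂ) (γ : ℝ) (z w : ℂ) :
    hform (t * α) (t * β) (t * γ) z w = t * hform α β γ z w := by
  simp only [hform, Complex.normSq_apply, Complex.star_def, Complex.mul_re, Complex.mul_im,
    Complex.conj_re, Complex.conj_im, Complex.ofReal_re, Complex.ofReal_im]
  ring

lemma hset_scale {t : ℝ} (ht : 0 < t) (α : ℝ) (β : ℂ) (γ : ℝ) :
    hset (t * α) (t * β) (t * γ) = hset α β γ := by
  ext x
  induction x using OnePoint.rec with
  | infty => simp [mul_nonpos_iff, ht.not_ge, ht.le]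
  | coe z => simp [hform_scale, mul_nonpos_iff, ht.not_ge, ht.le]

/-- In homogeneous coordinates this is congruence of the form by `g`. Rescaling the coordinates by t
multiplies the form by |t|², so its sign is well defined on the sphere, ∞ being (1 : 0). -/
lemma smul_mem_hset (g : GL (Fin 2) ℂ) (α : ℝ) (β : ℂ) (γ : ℝ) (x : Sphere) :
    g • x ∈ hset α β γ ↔ x ∈ hset (hform α β γ (g 0 0) (g 1 0))
      (α * g 0 0 * star (g 0 1) + β * g 0 0 * star (g 1 1) + star β * g 1 0 * star (g 0 1)
        + γ * g 1 0 * star (g 1 1)) (hform α β γ (g 0 1) (g 1 1)) := by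
  have key : ∀ z w : ℂ, w ≠ 0 → (hform α β γ (z / w) 1 ≤ 0 ↔ hform α β γ z w ≤ 0) := by
    intro z w hw
    have h := hform_smul α β γ w (z / w) 1
    rw [mul_div_cancel₀ _ hw, mul_one] at h
    have := Complex.normSq_pos.2 hw
    simp [h, mul_nonpos_iff, this.not_ge, this.le]
  have key0 : ∀ z : ℂ, z ≠ 0 → (α ≤ 0 ↔ hform α β γ z 0 ≤ 0) := by
    intro z hz
    have := Complex.normSq_pos.2 hz
    simp [hform, mul_nonpos_iff, this.not_ge, this.le]
  have hdet : g 0 0 * g 1 1 - g 0 1 * g 1 0 ≠ 0 := by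
    have := g.det_ne_zero
    rwa [Matrix.det_fin_two] at this
  induction x using OnePoint.rec with
  | infty =>
    rw [OnePoint.smul_infty_eq_ite, infty_mem_hset]
    split_ifs with h
    · rw [infty_mem_hset, h]
      exact key0 _ (by rintro h'; simp [h, h'] at hdet)
    · rw [coe_mem_hset]
      exact key _ _ h
  | coe z =>
    have hz : hform (hform α β γ (g 0 0) (g 1 0))
      (α * g 0 0 * star (g 0 1) + β * g 0 0 * star (g 1 1) + star β * g 1 0 * star (g 0 1)
        + γ * g 1 0 * star (g 1 1)) (hform α β γ (g 0 1) (g 1 1)) z 1 =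
        hform α β γ (g 0 0 * z + g 0 1) (g 1 0 * z + g 1 1) := by
      simp only [hform, Complex.normSq_apply, Complex.star_def, Complex.mul_re, Complex.mul_im,
        Complex.conj_re, Complex.conj_im, Complex.add_re, Complex.add_im, Complex.ofReal_re,
        Complex.ofReal_im, Complex.one_re, Complex.one_im]
      ring
    rw [OnePoint.smul_some_eq_ite, coe_mem_hset, hz]
    split_ifs with h
    · rw [infty_mem_hset, h]
      refine key0 _ fun h' => hdet ?_
      by_cases hc : g 1 0 = 0
      · simp only [hc, zero_mul, zero_add] at h
        rw [h, hc]; ring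
      · have : z = - g 1 1 / g 1 0 := by field_simp; linear_combination h
        rw [this] at h'
        field_simp at h'
        linear_combination -h'
    · rw [coe_mem_hset]
      exact key _ _ h

lemma smul_eq_hset {g : GL (Fin 2) ℂ} {D : Set Sphere} {α : ℝ} {β : ℂ} {γ : ℝ}
    (h : D = hset (hform α β γ (g 0 0) (g 1 0))
      (α * g 0 0 * star (g 0 1) + β * g 0 0 * star (g 1 1) + star β * g 1 0 * star (g 0 1)
        + γ * g 1 0 * star (g 1 1)) (hform α β γ (g 0 1) (g 1 1))) :
    g • D = hset α β γ := by
  rw [smul_eq_iff_eq_inv_smul]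
  ext x
  rw [Set.mem_inv_smul_set_iff, smul_mem_hset, h]

lemma coe_mem_euclDisc {z w : ℂ} {r : ℝ} : (w : Sphere) ∈ euclDisc z r ↔ ‖w - z‖ ≤ r := by
  simp [euclDisc, dist_eq_norm]

lemma infty_notMem_euclDisc {z : ℂ} {r : ℝ} : OnePoint.infty ∉ euclDisc z r := by
  simp [euclDisc]

lemma coe_mem_withInfty {H : Set ℂ} {w : ℂ} : (w : Sphere) ∈ withInfty H ↔ w ∈ H := by
  simp [withInfty]

lemma infty_mem_withInfty {H : Set ℂ} : OnePoint.infty ∈ withInfty H := by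
  simp [withInfty]

lemma hform_euclDisc (z : ℂ) (r : ℝ) (w : ℂ) :
    hform 1 (-star z) (Complex.normSq z - r ^ 2) w 1 = ‖w - z‖ ^ 2 - r ^ 2 := by
  rw [← Complex.normSq_eq_norm_sq]
  simp only [hform, Complex.normSq_apply, Complex.star_def, Complex.mul_re, Complex.mul_im,
    Complex.conj_re, Complex.conj_im, Complex.sub_re, Complex.sub_im, Complex.one_re,
    Complex.one_im, Complex.neg_re, Complex.neg_im]
  ring

lemma euclDisc_eq_hset {z : ℂ} {r : ℝ} (hr : 0 ≤ r) :
    euclDisc z r = hset 1 (-star z) (Complex.normSq z - r ^ 2) := by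
  ext x
  induction x using OnePoint.rec with
  | infty => simp [infty_notMem_euclDisc]
  | coe w =>
    rw [coe_mem_euclDisc, coe_mem_hset, hform_euclDisc, sub_nonpos, sq_le_sq₀ (norm_nonneg _) hr]

/-- The completed closed upper half plane. -/
abbrev upperDisc : Set Sphere := withInfty {z | 0 ≤ z.im}

/-- The completed half plane `y ≤ -2`. -/
abbrev lowerDisc : Set Sphere := withInfty {z | z.im ≤ -2}

lemma upperDisc_eq_hset : upperDisc = hset 0 (Complex.I / 2) 0 := by
  ext x
  induction x using OnePoint.rec with
  | infty => simp [infty_mem_withInfty]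
  | coe w => simp [coe_mem_withInfty, hform, Complex.mul_re]

lemma lowerDisc_eq_hset : lowerDisc = hset 0 (-Complex.I / 2) 2 := by
  ext x
  induction x using OnePoint.rec with
  | infty => simp [infty_mem_withInfty]
  | coe w =>
    simp [coe_mem_withInfty, hform, Complex.mul_re]
    constructor <;> intro h <;> linarith

/-- Every disc of the sphere is the negative set of an indefinite Hermitian form. -/
lemma IsDisc.exists_hset {D : Set Sphere} (hD : IsDisc D) :
    ∃ (α : ℝ) (β : ℂ) (γ : ℝ), α * γ < Complex.normSq β ∧ D = hset α β γ := by
  obtain ⟨g, rfl⟩ := hD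
  have hdet := (g⁻¹).det_ne_zero
  rw [Matrix.det_fin_two] at hdet
  have h := Complex.normSq_pos.2 hdet
  set k := g⁻¹ with hk
  refine ⟨hform 1 0 (-1) (k 0 0) (k 1 0), 1 * k 0 0 * star (k 0 1) + 0 * k 0 0 * star (k 1 1) +
    star 0 * k 1 0 * star (k 0 1) + (-1) * k 1 0 * star (k 1 1),
    hform 1 0 (-1) (k 0 1) (k 1 1), ?_, ?_⟩
  -- Congruence multiplies αγ - |β|² by |det k|², and the form of the unit disc has the value -1.
  · have : 0 < Complex.normSq (k 0 0 * k 1 1 - k 0 1 * k 1 0) := h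
    rw [← sub_pos]
    convert this using 1
    simp only [hform, Complex.normSq_apply, Complex.star_def, Complex.mul_re, Complex.mul_im,
        Complex.conj_re, Complex.conj_im, Complex.add_re, Complex.add_im, Complex.sub_re,
        Complex.sub_im, Complex.one_re, Complex.one_im, Complex.zero_re, Complex.zero_im,
        Complex.neg_re, Complex.neg_im]
    ring
  · have hg : g = k⁻¹ := by simp [hk]
    rw [hg]
    ext x
    rw [Set.mem_inv_smul_set_iff, euclDisc_eq_hset zero_le_one]
    have := smul_mem_hset k 1 0 (-1) x
    push_cast at this
    simpa using this

/-! ### The base patch in normalized position -/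

lemma smul_hset_eq {g : GL (Fin 2) ℂ} {α α₀ : ℝ} {β β₀ : ℂ} {γ γ₀ : ℝ} (t : ℝ) (ht : 0 < t)
    (hα : hform α β γ (g 0 0) (g 1 0) = t * α₀)
    (hβ : α * g 0 0 * star (g 0 1) + β * g 0 0 * star (g 1 1) + star β * g 1 0 * star (g 0 1)
        + γ * g 1 0 * star (g 1 1) = t * β₀)
    (hγ : hform α β γ (g 0 1) (g 1 1) = t * γ₀) :
    g • hset α₀ β₀ γ₀ = hset α β γ :=
  smul_eq_hset (by rw [hα, hβ, hγ, hset_scale ht])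

/-- The Möbius transformation taking `baseV`, `baseW`, `baseA` to the unit disc centred at `-i`,
the upper half plane and the half plane `y ≤ -2`. -/
def faceMap : GL (Fin 2) ℂ :=
  Matrix.GeneralLinearGroup.mkOfDetNeZero
    -- Determined by the tangency points: V∩W = 1 ↦ 0, W∩A = (-1+√3 i)/2 ↦ ∞, V∩A = (-1-√3 i)/2 ↦
    -- -2i.
    !![⟨√3, -1⟩, ⟨-√3, 1⟩; 1, ⟨1 / 2, -√3 / 2⟩] (by
      intro h
      have h3 : (√3 : ℝ) ^ 2 = 3 := Real.sq_sqrt (by norm_num)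
      have h1 := congrArg Complex.re h
      simp [Matrix.det_fin_two] at h1
      nlinarith [Real.sqrt_pos.2 (show (0 : ℝ) < 3 by norm_num)])

/-- The Möbius transformation taking `baseV`, `baseW`, `baseB` to the half plane `y ≤ -2`, the upper
half plane and the unit disc centred at `-i`. -/
def oppositeFaceMap : GL (Fin 2) ℂ :=
  Matrix.GeneralLinearGroup.mkOfDetNeZero
    -- Here V∩W = 1 ↦ ∞, W∩B = (5+√3 i)/2 ↦ 0, V∩B = (5-√3 i)/2 ↦ -2i.
    !![⟨√3, -1⟩, ⟨-3 * √3, 1⟩; 1, -1] (by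
      intro h
      have h1 := congrArg Complex.re h
      simp [Matrix.det_fin_two] at h1
      linarith [Real.sqrt_pos.2 (show (0 : ℝ) < 3 by norm_num)])

lemma sqrt_three_sq : (√3 : ℝ) ^ 2 = 3 := Real.sq_sqrt (by norm_num)

lemma baseV_eq_hset : baseV = hset 1 ⟨-1, -√3⟩ 1 := by
  rw [baseV, euclDisc_eq_hset (Real.sqrt_nonneg _)]
  congr 1
  · apply Complex.ext <;> simp
  · rw [Complex.normSq_mk]; ring

lemma baseW_eq_hset : baseW = hset 1 ⟨-1, √3⟩ 1 := by
  rw [baseW, euclDisc_eq_hset (Real.sqrt_nonneg _)]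
  congr 1
  · apply Complex.ext <;> simp
  · rw [Complex.normSq_mk]; ring

lemma baseA_eq_hset : baseA = hset 1 2 1 := by
  rw [baseA, euclDisc_eq_hset (Real.sqrt_nonneg _), sqrt_three_sq]
  congr 1
  · apply Complex.ext <;> simp
  · rw [Complex.normSq_apply]; norm_num

lemma baseB_eq_hset : baseB = hset 1 (-4) 13 := by
  rw [baseB, euclDisc_eq_hset (Real.sqrt_nonneg _), sqrt_three_sq]
  congr 1
  · apply Complex.ext <;> simp
  · rw [Complex.normSq_apply]; norm_num

lemma unitDisc_eq_hset (x : ℝ) : euclDisc (x - Complex.I) 1 = hset 1 ⟨-x, -1⟩ (x ^ 2) := by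
  rw [euclDisc_eq_hset zero_le_one]
  congr 1
  · apply Complex.ext <;> simp
  · rw [Complex.normSq_apply]; simp; ring

lemma faceMap_entries : faceMap 0 0 = ⟨√3, -1⟩ ∧ faceMap 0 1 = ⟨-√3, 1⟩ ∧ faceMap 1 0 = 1 ∧
    faceMap 1 1 = ⟨1 / 2, -√3 / 2⟩ := ⟨rfl, rfl, rfl, rfl⟩

lemma oppositeFaceMap_entries : oppositeFaceMap 0 0 = ⟨√3, -1⟩ ∧
    oppositeFaceMap 0 1 = ⟨-3 * √3, 1⟩ ∧ oppositeFaceMap 1 0 = 1 ∧ oppositeFaceMap 1 1 = -1 :=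
  ⟨rfl, rfl, rfl, rfl⟩

lemma faceMap_smul_baseV : faceMap • baseV = euclDisc (-Complex.I) 1 := by
  obtain ⟨h1, h2, h3, h4⟩ := faceMap_entries
  have h := sqrt_three_sq
  have hd := unitDisc_eq_hset 0
  rw [Complex.ofReal_zero, zero_sub] at hd
  rw [baseV_eq_hset, hd]
  apply smul_hset_eq 2 two_pos <;> simp only [h1, h2, h3, h4]
  · simp [hform, Complex.normSq_apply]; linarith
  · apply Complex.ext <;> simp <;> linarith
  · simp [hform, Complex.normSq_apply]; linarith

lemma faceMap_smul_baseW : faceMap • baseW = upperDisc := by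
  obtain ⟨h1, h2, h3, h4⟩ := faceMap_entries
  have h := sqrt_three_sq
  rw [baseW_eq_hset, upperDisc_eq_hset]
  apply smul_hset_eq 1 one_pos <;> simp only [h1, h2, h3, h4]
  · simp [hform, Complex.normSq_apply]
  · apply Complex.ext <;> simp <;> linarith
  · simp [hform, Complex.normSq_apply]; linarith

lemma faceMap_smul_baseA : faceMap • baseA = lowerDisc := by
  obtain ⟨h1, h2, h3, h4⟩ := faceMap_entries
  have h := sqrt_three_sq
  rw [baseA_eq_hset, lowerDisc_eq_hset]
  apply smul_hset_eq 1 one_pos <;> simp only [h1, h2, h3, h4]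
  · simp [hform, Complex.normSq_apply]; linarith
  · apply Complex.ext <;> simp <;> linarith
  · simp [hform, Complex.normSq_apply]; linarith

lemma oppositeFaceMap_smul_baseV : oppositeFaceMap • baseV = lowerDisc := by
  obtain ⟨h1, h2, h3, h4⟩ := oppositeFaceMap_entries
  have h := sqrt_three_sq
  rw [baseV_eq_hset, lowerDisc_eq_hset]
  apply smul_hset_eq 1 one_pos <;> simp only [h1, h2, h3, h4]
  · simp [hform, Complex.normSq_apply]; linarith
  · apply Complex.ext <;> simp <;> linarith
  · simp [hform, Complex.normSq_apply]; linarith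

lemma oppositeFaceMap_smul_baseW : oppositeFaceMap • baseW = upperDisc := by
  obtain ⟨h1, h2, h3, h4⟩ := oppositeFaceMap_entries
  have h := sqrt_three_sq
  rw [baseW_eq_hset, upperDisc_eq_hset]
  apply smul_hset_eq 1 one_pos <;> simp only [h1, h2, h3, h4]
  · simp [hform, Complex.normSq_apply]
  · apply Complex.ext <;> simp <;> linarith
  · simp [hform, Complex.normSq_apply]

lemma oppositeFaceMap_smul_baseB : oppositeFaceMap • baseB = euclDisc (-Complex.I) 1 := by
  obtain ⟨h1, h2, h3, h4⟩ := oppositeFaceMap_entries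
  have h := sqrt_three_sq
  have hd := unitDisc_eq_hset 0
  rw [Complex.ofReal_zero, zero_sub] at hd
  rw [baseB_eq_hset, hd]
  apply smul_hset_eq 2 two_pos <;> simp only [h1, h2, h3, h4]
  · simp [hform, Complex.normSq_apply]; linarith
  · apply Complex.ext <;> simp <;> linarith
  · simp [hform, Complex.normSq_apply]; linarith

/-- `oppositeFaceMap` is z ↦ √3 - i - 2√3/(z-1), and M_s adds s to 1/(z-1). So M_s becomes the
translation by -2√3 s, applied to the unit disc about 2√3 - i that is the image of `baseA`. -/
lemma oppositeFaceMap_mul_parabolicM_smul_baseA (s : ℝ) :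
    (oppositeFaceMap * parabolicM s) • baseA =
      euclDisc (((2 * √3 * (1 - s) : ℝ) : ℂ) - Complex.I) 1 := by
  have e : ∀ i j, (oppositeFaceMap * parabolicM s) i j =
      oppositeFaceMap i 0 * parabolicM s 0 j + oppositeFaceMap i 1 * parabolicM s 1 j :=
    fun i j => by rw [Units.val_mul, Matrix.mul_apply, Fin.sum_univ_two]
  obtain ⟨h1, h2, h3, h4⟩ := oppositeFaceMap_entries
  have h' : (√3 : ℂ) ^ 2 = 3 := by exact_mod_cast congrArg ((↑) : ℝ → ℂ) sqrt_three_sq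
  have m1 : parabolicM s 0 0 = 1 + s := rfl
  have m2 : parabolicM s 0 1 = -s := rfl
  have m3 : parabolicM s 1 0 = s := rfl
  have m4 : parabolicM s 1 1 = 1 - s := rfl
  have h := sqrt_three_sq
  rw [baseA_eq_hset, unitDisc_eq_hset]
  apply smul_hset_eq 2 two_pos <;> simp only [e, h1, h2, h3, h4, m1, m2, m3, m4]
  · simp [hform, Complex.normSq_apply]
    ring_nf
    rw [h]
    ring
  · apply Complex.ext <;> simp <;> ring_nf <;> simp only [h'] <;> simp [sq] <;> ring
  · simp [hform, Complex.normSq_apply]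
    ring_nf
    rw [h]
    ring

/-! ### Rigidity -/

lemma upperDisc_inter_lowerDisc : upperDisc ∩ lowerDisc = {OnePoint.infty} := by
  ext x
  induction x using OnePoint.rec with
  | infty => simp [infty_mem_withInfty]
  | coe w =>
    simp only [Set.mem_inter_iff, coe_mem_withInfty, Set.mem_ofPred_eq, Set.mem_singleton_iff,
      OnePoint.coe_ne_infty, iff_false]
    rintro ⟨h, h'⟩
    linarith

lemma coe_mem_euclDisc_iff {z w : ℂ} {r : ℝ} (hr : 0 ≤ r) :
    (w : Sphere) ∈ euclDisc z r ↔ (w.re - z.re) ^ 2 + (w.im - z.im) ^ 2 ≤ r ^ 2 := by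
  rw [coe_mem_euclDisc, ← sq_le_sq₀ (norm_nonneg _) hr, ← Complex.normSq_eq_norm_sq,
    Complex.normSq_apply, Complex.sub_re, Complex.sub_im, ← sq, ← sq]

lemma upperDisc_inter_unitDisc (x : ℝ) :
    upperDisc ∩ euclDisc (x - Complex.I) 1 = {((x : ℂ) : Sphere)} := by
  ext y
  induction y using OnePoint.rec with
  | infty => simp [infty_notMem_euclDisc]
  | coe w =>
    simp only [Set.mem_inter_iff, coe_mem_withInfty, Set.mem_ofPred_eq, Set.mem_singleton_iff,
      OnePoint.coe_eq_coe, coe_mem_euclDisc_iff zero_le_one]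
    simp only [Complex.sub_re, Complex.sub_im, Complex.ofReal_re, Complex.ofReal_im, Complex.I_re,
      Complex.I_im]
    constructor
    · rintro ⟨h, h'⟩
      have him : w.im = 0 := by nlinarith [sq_nonneg (w.re - x - 0)]
      rw [him] at h'
      have hre : w.re - x - 0 = 0 := by
        apply pow_eq_zero_iff two_ne_zero |>.1
        nlinarith [sq_nonneg (w.re - x - 0)]
      apply Complex.ext <;> simp <;> linarith
    · rintro rfl
      simp

lemma lowerDisc_inter_unitDisc (x : ℝ) :
    lowerDisc ∩ euclDisc (x - Complex.I) 1 = {((x - 2 * Complex.I : ℂ) : Sphere)} := by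
  ext y
  induction y using OnePoint.rec with
  | infty => simp [infty_notMem_euclDisc]
  | coe w =>
    simp only [Set.mem_inter_iff, coe_mem_withInfty, Set.mem_ofPred_eq, Set.mem_singleton_iff,
      OnePoint.coe_eq_coe, coe_mem_euclDisc_iff zero_le_one]
    simp only [Complex.sub_re, Complex.sub_im, Complex.ofReal_re, Complex.ofReal_im, Complex.I_re,
      Complex.I_im]
    constructor
    · rintro ⟨h, h'⟩
      have him : w.im = -2 := by nlinarith [sq_nonneg (w.re - x - 0)]
      rw [him] at h'
      have hre : w.re - x - 0 = 0 := by
        apply pow_eq_zero_iff two_ne_zero |>.1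
        nlinarith [sq_nonneg (w.re - x - 0)]
      apply Complex.ext <;> simp <;> linarith
    · rintro rfl
      norm_num

lemma smul_eq_self_of_smul_inter {g : GL (Fin 2) ℂ} {D E : Set Sphere} {t : Sphere}
    (hD : g • D = D) (hE : g • E = E) (h : D ∩ E = {t}) : g • t = t := by
  have : g • (D ∩ E) = D ∩ E := by rw [Set.smul_set_inter, hD, hE]
  rwa [h, Set.smul_set_singleton, Set.singleton_eq_singleton_iff] at this

/-- A Möbius transformation preserving three mutually tangent discs is trivial. -/
lemma smul_eq_self_of_normalized {g : GL (Fin 2) ℂ} (hu : g • upperDisc = upperDisc)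
    (hl : g • lowerDisc = lowerDisc)
    (hd : g • euclDisc (-Complex.I) 1 = euclDisc (-Complex.I) 1) (S : Set Sphere) : g • S = S := by
  have e1 := upperDisc_inter_unitDisc 0
  have e2 := lowerDisc_inter_unitDisc 0
  simp only [Complex.ofReal_zero, zero_sub] at e1 e2
  -- The fixed tangency points ∞, 0, -2i give in turn c = 0, b = 0 and a = d.
  have h1 := smul_eq_self_of_smul_inter hu hl upperDisc_inter_lowerDisc
  have h2 := smul_eq_self_of_smul_inter hu hd e1
  have h3 := smul_eq_self_of_smul_inter hl hd e2
  have hdet : g 0 0 * g 1 1 - g 0 1 * g 1 0 ≠ 0 := by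
    have := g.det_ne_zero
    rwa [Matrix.det_fin_two] at this
  rw [OnePoint.smul_infty_eq_self_iff] at h1
  have hd0 : g 1 1 ≠ 0 := by rintro h; simp [h, h1] at hdet
  rw [OnePoint.smul_some_eq_ite, if_neg (by simp [hd0]), OnePoint.coe_eq_coe,
    div_eq_zero_iff, mul_zero, mul_zero, zero_add, zero_add, or_iff_left hd0] at h2
  rw [OnePoint.smul_some_eq_ite, h1, zero_mul, zero_add, if_neg hd0, OnePoint.coe_eq_coe,
    div_eq_iff hd0, h2, add_zero] at h3
  have h4 : g 0 0 = g 1 1 := by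
    have : (-(2 * Complex.I)) ≠ 0 := by simp
    exact mul_right_cancel₀ this (by rw [h3, mul_comm])
  have h5 : ∀ x : Sphere, g • x = x := by
    intro x
    induction x using OnePoint.rec with
    | infty => rwa [OnePoint.smul_infty_eq_self_iff]
    | coe w =>
      rw [OnePoint.smul_some_eq_ite, h1, h2, h4, zero_mul, zero_add, if_neg hd0, add_zero,
        mul_div_cancel_left₀ _ hd0]
  ext x
  rw [Set.mem_smul_set_iff_inv_smul_mem, inv_smul_eq_iff.2 (h5 x).symm]

/-- A Möbius transformation is determined by its values on three mutually tangent discs. -/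
lemma smul_eq_smul_of_normalized {g h k : GL (Fin 2) ℂ} {D E F : Set Sphere}
    (hD : k • D = upperDisc) (hE : k • E = lowerDisc) (hF : k • F = euclDisc (-Complex.I) 1)
    (h1 : g • D = h • D) (h2 : g • E = h • E) (h3 : g • F = h • F) (S : Set Sphere) :
    g • S = h • S := by
  have key : ∀ {A B : Set Sphere}, k • A = B → g • A = h • A → (k * h⁻¹ * g * k⁻¹) • B = B := by
    rintro A B rfl h'
    simp only [mul_smul, inv_smul_smul, h']
  have := smul_eq_self_of_normalized (key hD h1) (key hE h2) (key hF h3) (k • S)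
  simp only [mul_smul, inv_smul_smul] at this
  rwa [smul_left_cancel_iff, inv_smul_eq_iff] at this

lemma smul_eq_smul_of_baseA {g h : GL (Fin 2) ℂ} (hV : g • baseV = h • baseV)
    (hW : g • baseW = h • baseW) (hA : g • baseA = h • baseA) (S : Set Sphere) : g • S = h • S :=
  smul_eq_smul_of_normalized faceMap_smul_baseW faceMap_smul_baseA faceMap_smul_baseV hW hA hV S

lemma smul_eq_smul_of_baseB {g h : GL (Fin 2) ℂ} (hV : g • baseV = h • baseV)
    (hW : g • baseW = h • baseW) (hB : g • baseB = h • baseB) (S : Set Sphere) : g • S = h • S :=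
  smul_eq_smul_of_normalized oppositeFaceMap_smul_baseW oppositeFaceMap_smul_baseV
    oppositeFaceMap_smul_baseB hW hV hB S

/-- The action of mf on sets is determined by v, w, a, and mg = mf M_s⁻¹ then determines b. -/
lemma IsSchwarzian.eq_of_eq {v w a b b' : Set Sphere} {s : ℝ} (h : IsSchwarzian v w a b s)
    (h' : IsSchwarzian v w a b' s) : b = b' := by
  obtain ⟨f, g, ⟨hfV, hfW, hfA⟩, ⟨-, -, hgB⟩, hM⟩ := h
  obtain ⟨f', g', ⟨hfV', hfW', hfA'⟩, ⟨-, -, hgB'⟩, hM'⟩ := h'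
  have hg : g = f * (parabolicM s)⁻¹ := by rw [← hM]; group
  have hg' : g' = f' * (parabolicM s)⁻¹ := by rw [← hM']; group
  rw [← hgB, ← hgB', hg, hg', mul_smul, mul_smul]
  exact smul_eq_smul_of_baseA (hfV.trans hfV'.symm) (hfW.trans hfW'.symm) (hfA.trans hfA'.symm) _

/-- In the normalized position of the patch `{v, w | a, b}`, the disc `a` is at distance
`2√3 (1 - s)` from `b`. -/
lemma IsSchwarzian.eq_unitDisc {a : Set Sphere} {s : ℝ}
    (h : IsSchwarzian lowerDisc upperDisc a (euclDisc (-Complex.I) 1) s) :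
    a = euclDisc (((2 * √3 * (1 - s) : ℝ) : ℂ) - Complex.I) 1 := by
  obtain ⟨f, g, ⟨-, -, hfA⟩, ⟨hgV, hgW, hgB⟩, hM⟩ := h
  have hf : f = g * parabolicM s := by rw [← hM]; group
  rw [← hfA, hf, ← oppositeFaceMap_mul_parabolicM_smul_baseA, mul_smul, mul_smul]
  exact smul_eq_smul_of_baseB (hgV.trans oppositeFaceMap_smul_baseV.symm)
    (hgW.trans oppositeFaceMap_smul_baseW.symm) (hgB.trans oppositeFaceMap_smul_baseB.symm) _

lemma IsSchwarzian.smul {v w a b : Set Sphere} {s : ℝ} (h : IsSchwarzian v w a b s)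
    (g : GL (Fin 2) ℂ) : IsSchwarzian (g • v) (g • w) (g • a) (g • b) s := by
  obtain ⟨mf, mg, ⟨rfl, rfl, rfl⟩, ⟨h1, h2, rfl⟩, hM⟩ := h
  refine ⟨g * mf, g * mg, ⟨mul_smul _ _ _, mul_smul _ _ _, mul_smul _ _ _⟩,
    ⟨by rw [mul_smul, h1], by rw [mul_smul, h2], mul_smul _ _ _⟩, ?_⟩
  rw [← hM, mul_inv_rev, mul_assoc, inv_mul_cancel_left]

/-! ### Flowers under Möbius transformations and rotations -/

lemma IsDisc.smul {D : Set Sphere} (h : IsDisc D) (g : GL (Fin 2) ℂ) : IsDisc (g • D) := by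
  obtain ⟨k, rfl⟩ := h
  exact ⟨g * k, smul_smul _ _ _⟩

lemma IsDisc.isClosed {D : Set Sphere} (h : IsDisc D) : IsClosed D := by
  obtain ⟨k, rfl⟩ := h
  exact (((isCompact_closedBall _ _).image OnePoint.continuous_coe).isClosed).smul k

lemma TangentAt.smul {D E : Set Sphere} {t : Sphere} (h : TangentAt D E t) (g : GL (Fin 2) ℂ) :
    TangentAt (g • D) (g • E) (g • t) := by
  have hf : ∀ S : Set Sphere, frontier (g • S) = g • frontier S := fun S => by
    rw [frontier, frontier, closure_smul, interior_smul, Set.smul_set_sdiff]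
  refine ⟨?_, ?_⟩
  · rw [hf, hf, ← Set.smul_set_inter, h.1, Set.smul_set_singleton]
  · rw [interior_smul, interior_smul]
    exact Set.disjoint_smul_set.2 h.2

/-- Allows tangency points to be found by intersecting closed discs, without computing frontiers. -/
lemma TangentAt.mem_inter {D E : Set Sphere} {t : Sphere} (h : TangentAt D E t)
    (hD : IsClosed D) (hE : IsClosed E) : t ∈ D ∩ E :=
  Set.inter_subset_inter hD.frontier_subset hE.frontier_subset (h.1.symm ▸ Set.mem_singleton t)

namespace Flower

variable {n : ℕ}

/-- The image of a flower under a Möbius transformation. -/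
def mobius (F : Flower n) (g : GL (Fin 2) ℂ) : Flower n where
  center := g • F.center
  petal j := g • F.petal j
  isDisc_center := F.isDisc_center.smul g
  isDisc_petal j := (F.isDisc_petal j).smul g
  tangent_center j := (F.tangent_center j).imp' (g • ·) fun _ h => h.smul g
  tangent_succ j := (F.tangent_succ j).imp' (g • ·) fun _ h => h.smul g

/-- The flower with the numbering of its petals shifted, so that the petal `c_k` becomes `c_0`. -/
def rotate (F : Flower n) (k : ZMod n) : Flower n where
  center := F.center
  petal j := F.petal (j + k)
  isDisc_center := F.isDisc_center
  isDisc_petal j := F.isDisc_petal (j + k)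
  tangent_center j := F.tangent_center (j + k)
  tangent_succ j := by
    rw [add_right_comm]
    exact F.tangent_succ (j + k)

lemma HasLabel.mobius {F : Flower n} {p : ZMod n → ℝ} (h : F.HasLabel p) (g : GL (Fin 2) ℂ) :
    (F.mobius g).HasLabel p :=
  fun j => (h j).smul g

lemma HasLabel.rotate {F : Flower n} {p : ZMod n → ℝ} (h : F.HasLabel p) (k : ZMod n) :
    (F.rotate k).HasLabel (shift k p) := by
  intro j
  change IsSchwarzian (F.petal (j + k)) F.center (F.petal (j - 1 + k)) (F.petal (j + 1 + k)) _
  rw [sub_add_eq_add_sub, add_right_comm]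
  exact h (j + k)

lemma HasLabel.exists_isNormalized {F : Flower n} {p : ZMod n → ℝ} (h : F.HasLabel p) :
    ∃ g, (F.mobius g).IsNormalized := by
  -- The schwarzian at `c_1` already presents the face (`c_1`, `C`, `c_0`) as a Möbius image of the
  -- base face.
  obtain ⟨f, -, ⟨hV, hW, hA⟩, -⟩ := h 1
  rw [sub_self] at hA
  refine ⟨faceMap * f⁻¹, ?_, ?_, ?_⟩
  · simp only [Flower.mobius, ← hW, mul_smul, inv_smul_smul, faceMap_smul_baseW]
  · simp only [Flower.mobius, ← hA, mul_smul, inv_smul_smul, faceMap_smul_baseA]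
  · simp only [Flower.mobius, ← hV, mul_smul, inv_smul_smul, faceMap_smul_baseV]

/-- The normalized layout of a label is unique. -/
lemma IsNormalized.petal_eq {G G' : Flower n} {p : ZMod n → ℝ} (hG : G.IsNormalized)
    (hG' : G'.IsNormalized) (h : G.HasLabel p) (h' : G'.HasLabel p) (m : ℕ) :
    G.petal m = G'.petal m := by
  -- Two consecutive petals are carried along, since together with the schwarzian they determine the
  -- next one.
  suffices G.petal m = G'.petal m ∧ G.petal (m + 1 : ℕ) = G'.petal (m + 1 : ℕ) from this.1
  induction m with
  | zero =>
    simp only [Nat.cast_zero, zero_add, Nat.cast_one]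
    exact ⟨hG.2.1.trans hG'.2.1.symm, hG.2.2.trans hG'.2.2.symm⟩
  | succ m ih =>
    refine ⟨ih.2, ?_⟩
    have h1 := h (m + 1 : ℕ)
    have h2 := h' (m + 1 : ℕ)
    have e : ((m + 1 : ℕ) : ZMod n) - 1 = m := by push_cast; ring
    rw [e, ih.1, ih.2, hG.1] at h1
    rw [e, hG'.1] at h2
    rw [Nat.cast_succ (m + 1)]
    exact h1.eq_of_eq h2

end Flower

/-! ### Discs between the two half planes -/

lemma im_lt_of_mem_interior_lowerDisc {w : ℂ} (h : (w : Sphere) ∈ interior lowerDisc) :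
    w.im < -2 := by
  have h1 : (fun z : ℂ => (z : Sphere)) ⁻¹' interior lowerDisc ⊆ interior {z | z.im ≤ -2} :=
    interior_maximal (fun z hz => coe_mem_withInfty.1 (interior_subset hz))
      (isOpen_interior.preimage OnePoint.continuous_coe)
  have h2 := h1 h
  rwa [Complex.interior_setOfPred_im_le] at h2

lemma coe_mem_interior {S : Set Sphere} {P : ℂ → Prop} (hP : IsOpen {z | P z})
    (h : ∀ z, P z → (z : Sphere) ∈ S) {w : ℂ} (hw : P w) : (w : Sphere) ∈ interior S :=
  interior_maximal (Set.image_subset_iff.2 h) (OnePoint.isOpen_image_coe.2 hP) ⟨w, hw, rfl⟩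

lemma coe_mem_interior_upperDisc {w : ℂ} (h : 0 < w.im) : (w : Sphere) ∈ interior upperDisc :=
  coe_mem_interior (P := fun z => 0 < z.im) (isOpen_lt continuous_const Complex.continuous_im)
    (fun _ hz => coe_mem_withInfty.2 (Set.mem_ofPred.2 hz.le)) h

lemma coe_mem_interior_lowerDisc {w : ℂ} (h : w.im < -2) : (w : Sphere) ∈ interior lowerDisc :=
  coe_mem_interior (P := fun z => z.im < -2) (isOpen_lt Complex.continuous_im continuous_const)
    (fun _ hz => coe_mem_withInfty.2 (Set.mem_ofPred.2 hz.le)) h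

lemma continuous_hform (α : ℝ) (β : ℂ) (γ : ℝ) : Continuous fun z => hform α β γ z 1 := by
  have := Complex.continuous_normSq
  unfold hform
  fun_prop

lemma coe_mem_interior_hset {α : ℝ} {β : ℂ} {γ : ℝ} {w : ℂ} (h : hform α β γ w 1 < 0) :
    (w : Sphere) ∈ interior (hset α β γ) :=
  coe_mem_interior (P := fun z => hform α β γ z 1 < 0)
    (isOpen_lt (continuous_hform α β γ) continuous_const) (fun _ hz => coe_mem_hset.2 hz.le) h

lemma coe_mem_interior_euclDisc {z w : ℂ} {r : ℝ} (h : ‖w - z‖ < r) :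
    (w : Sphere) ∈ interior (euclDisc z r) :=
  coe_mem_interior (P := fun w => ‖w - z‖ < r) (isOpen_lt (by fun_prop) continuous_const)
    (fun _ hz => coe_mem_euclDisc.2 hz.le) h

/-- A disc of diameter at most 2 that reaches y ≥ 0 cannot go below y = -2. -/
lemma disjoint_interior_lowerDisc {z : ℂ} {r : ℝ} (hr : r ≤ 1)
    (h : (upperDisc ∩ euclDisc z r).Nonempty) :
    Disjoint (interior lowerDisc) (interior (euclDisc z r)) := by
  obtain ⟨-, hx, w, hw, rfl⟩ := h
  rw [coe_mem_withInfty, Set.mem_ofPred_eq] at hx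
  rw [Set.disjoint_left]
  rintro x hx' hx''
  obtain ⟨v, hv, rfl⟩ := interior_subset hx''
  have h1 := im_lt_of_mem_interior_lowerDisc hx'
  rw [Metric.mem_closedBall, dist_eq_norm] at hv hw
  have h2 := (abs_le.1 ((Complex.abs_im_le_norm _).trans hv)).1
  have h3 := (abs_le.1 ((Complex.abs_im_le_norm _).trans hw)).2
  rw [Complex.sub_im] at h2 h3
  linarith

/-- A disc whose interior misses the half planes `y > 0` and `y < -2` is a Euclidean disc of radius
at most `1`. -/
lemma IsDisc.exists_euclDisc {D : Set Sphere} (hD : IsDisc D)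
    (hu : Disjoint (interior upperDisc) (interior D))
    (hl : Disjoint (interior lowerDisc) (interior D)) :
    ∃ (z : ℂ) (r : ℝ), 0 < r ∧ r ≤ 1 ∧ D = euclDisc z r := by
  obtain ⟨α, β, γ, hdet, rfl⟩ := hD.exists_hset
  have hu' : ∀ w, hform α β γ w 1 < 0 → w.im ≤ 0 := fun w hw => by
    by_contra! h
    exact Set.disjoint_left.1 hu (coe_mem_interior_upperDisc h) (coe_mem_interior_hset hw)
  have hl' : ∀ w, hform α β γ w 1 < 0 → -2 ≤ w.im := fun w hw => by
    by_contra! h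
    exact Set.disjoint_left.1 hl (coe_mem_interior_lowerDisc h) (coe_mem_interior_hset hw)
  have form : ∀ x y : ℝ, hform α β γ ⟨x, y⟩ 1 =
      α * (x * x + y * y) + 2 * (β.re * x - β.im * y) + γ := fun x y => by
    simp [hform, Complex.normSq_apply]
  rw [Complex.normSq_apply] at hdet
  rcases lt_trichotomy α 0 with hα | rfl | hα
  · exfalso
    -- For α < 0 the set is a neighbourhood of ∞; this y makes αy² outweigh the other terms at the
    -- point iy.
    set y := 1 + (2 * |β.im| + |γ|) / (-α) with hy
    have hy1 : 1 ≤ y := by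
      have : 0 ≤ (2 * |β.im| + |γ|) / (-α) := div_nonneg (by positivity) (by linarith)
      linarith
    have hy2 : α * y = α - (2 * |β.im| + |γ|) := by
      have := hα.ne
      rw [hy, div_neg, mul_add, mul_neg, mul_div_cancel₀ _ this]; ring
    have := hu' ⟨0, y⟩ (by
      rw [form]
      have e : α * (0 * 0 + y * y) = (α - (2 * |β.im| + |γ|)) * y := by rw [← hy2]; ring
      rw [e]
      nlinarith [neg_abs_le β.im, le_abs_self γ, abs_nonneg γ])
    simp only at this
    linarith
  · exfalso
    have hβ : 0 < β.re * β.re + β.im * β.im := by linarith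
    set N := β.re * β.re + β.im * β.im with hN
    -- The set is a half plane. Along z = -s·conj β the form falls like -2s|β|²; adding i or -3i, by
    -- the sign of Im β, leaves the strip, and s is chosen to absorb the remaining terms.
    rcases le_total 0 β.im with hb | hb
    · set s := (2 * |β.im| + |γ| + 1) / N with hs
      have hs0 : 0 ≤ s := by positivity
      have hsN : s * N = 2 * |β.im| + |γ| + 1 := by rw [hs]; field_simp
      have := hu' ⟨-s * β.re, s * β.im + 1⟩ (by
        rw [form]
        have : 0 ≤ β.im * 1 := by linarith
        nlinarith [le_abs_self γ, abs_nonneg β.im, abs_nonneg γ])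
      simp only at this
      nlinarith
    · set s := (6 * |β.im| + |γ| + 1) / N with hs
      have hs0 : 0 ≤ s := by positivity
      have hsN : s * N = 6 * |β.im| + |γ| + 1 := by rw [hs]; field_simp
      have := hl' ⟨-s * β.re, s * β.im - 3⟩ (by
        rw [form]
        nlinarith [le_abs_self γ, abs_nonneg β.im, abs_nonneg γ, le_abs_self β.im])
      simp only at this
      nlinarith
  · set R := (β.re * β.re + β.im * β.im - α * γ) / α ^ 2 with hR
    have hR0 : 0 < R := div_pos (by linarith) (by positivity)
    have hsq : √R ^ 2 = R := Real.sq_sqrt hR0.le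
    have hr0 := Real.sqrt_pos.2 hR0
    have hset_eq : hset α β γ = euclDisc (-star β / α) √R := by
      rw [euclDisc_eq_hset hr0.le, ← hset_scale hα 1]
      have hα' : (α : ℂ) ≠ 0 := by exact_mod_cast hα.ne'
      congr 1
      · ring
      · rw [star_div₀, star_neg, star_star]
        simp only [Complex.star_def, Complex.conj_ofReal]
        field_simp
      · rw [hsq, hR, Complex.normSq_div, Complex.normSq_neg, Complex.star_def,
          Complex.normSq_conj, Complex.normSq_apply, Complex.normSq_ofReal]
        field_simp
        ring
    refine ⟨_, √R, hr0, ?_, hset_eq⟩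
    set z := -star β / (α : ℂ)
    rw [hset_eq] at hu hl
    have h1 : ∀ t : ℝ, |t| < √R → z.im + t ≤ 0 ∧ -2 ≤ z.im + t := by
      intro t ht
      have hm : ((z + t * Complex.I : ℂ) : Sphere) ∈ interior (euclDisc z √R) :=
        coe_mem_interior_euclDisc (by simpa using ht)
      constructor
      · by_contra! h
        exact Set.disjoint_left.1 hu (coe_mem_interior_upperDisc (by simpa using h)) hm
      · by_contra! h
        exact Set.disjoint_left.1 hl (coe_mem_interior_lowerDisc (by simpa using h)) hm
    by_contra! hr
    -- If √R > 1, the half-length (√R+1)/2 exceeds 1, so this vertical chord inside the disc is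
    -- longer than the strip is wide.
    have ha : |(√R + 1) / 2| < √R := by rw [abs_of_pos (by linarith)]; linarith
    have h2 := (h1 ((√R + 1) / 2) ha).1
    have h3 := (h1 (-((√R + 1) / 2)) (by rwa [abs_neg])).2
    linarith

/-! ### Orientation -/

/-- Splits a chord of the unit circle into a sine, whose sign carries the cyclic order, and a phase
that will cancel. -/
lemma exp_I_sub_exp_I (x y : ℝ) : Complex.exp (Complex.I * x) - Complex.exp (Complex.I * y) =
    2 * Complex.I * Real.sin ((x - y) / 2) * Complex.exp (Complex.I * ((x + y) / 2 : ℝ)) := by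
  have hx : Complex.I * (x : ℂ) = Complex.I * ((x - y) / 2 : ℝ) + Complex.I * ((x + y) / 2 : ℝ) := by
    push_cast; ring
  have hy : Complex.I * (y : ℂ) =
      -(Complex.I * ((x - y) / 2 : ℝ)) + Complex.I * ((x + y) / 2 : ℝ) := by
    push_cast; ring
  rw [hx, hy, Complex.exp_add, Complex.exp_add, Complex.ofReal_sin, ← sub_mul]
  congr 1
  rw [Complex.sin, mul_comm Complex.I]
  have := Complex.I_mul_I
  rw [← neg_mul]
  linear_combination (Complex.exp ((((x - y) / 2 : ℝ) : ℂ) * Complex.I)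
    - Complex.exp (-(((x - y) / 2 : ℝ) : ℂ) * Complex.I)) * this

/-- If a Möbius transformation takes the upper half plane to the unit disc and `∞`, `0`, `X` to
points of the unit circle that follow each other counterclockwise, then `X` is positive. -/
lemma pos_of_counterclockwise {h : GL (Fin 2) ℂ} (hu : h • upperDisc = euclDisc 0 1)
    {θ₀ θ₁ θ₂ X : ℝ} (h01 : θ₀ < θ₁) (h12 : θ₁ < θ₂) (h20 : θ₂ < θ₀ + 2 * Real.pi)
    (hinf : h • (OnePoint.infty : Sphere) = (Complex.exp (Complex.I * θ₀) : ℂ))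
    (hzero : h • (((0 : ℝ) : ℂ) : Sphere) = (Complex.exp (Complex.I * θ₁) : ℂ))
    (hX : h • ((X : ℂ) : Sphere) = (Complex.exp (Complex.I * θ₂) : ℂ)) : 0 < X := by
  set ζ₀ := Complex.exp (Complex.I * θ₀) with hζ₀
  set ζ₁ := Complex.exp (Complex.I * θ₁) with hζ₁
  set ζ₂ := Complex.exp (Complex.I * θ₂) with hζ₂
  have hd : euclDisc 0 1 = hset 1 0 (-1) := by
    rw [euclDisc_eq_hset zero_le_one]; norm_num
  have hβ : ((1 : ℝ) : ℂ) * h 0 0 * star (h 0 1) + 0 * h 0 0 * star (h 1 1) +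
      star 0 * h 1 0 * star (h 0 1) + ((-1 : ℝ) : ℂ) * h 1 0 * star (h 1 1) =
      h 0 0 * star (h 0 1) - h 1 0 * star (h 1 1) := by
    rw [star_zero]; push_cast; ring
  -- Comparing the pulled-back form at i (in the half plane) and at -i (outside) isolates its middle
  -- coefficient, whose imaginary part is therefore positive.
  have hp : hform (hform 1 0 (-1) (h 0 0) (h 1 0))
      (h 0 0 * star (h 0 1) - h 1 0 * star (h 1 1)) (hform 1 0 (-1) (h 0 1) (h 1 1))
      Complex.I 1 ≤ 0 := by
    have h1 : ((Complex.I : ℂ) : Sphere) ∈ upperDisc := coe_mem_withInfty.2 (by simp)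
    rw [← Set.smul_mem_smul_set_iff (a := h), hu, hd, smul_mem_hset, coe_mem_hset] at h1
    rwa [hβ] at h1
  have hm : 0 < hform (hform 1 0 (-1) (h 0 0) (h 1 0))
      (h 0 0 * star (h 0 1) - h 1 0 * star (h 1 1)) (hform 1 0 (-1) (h 0 1) (h 1 1))
      (-Complex.I) 1 := by
    have h1 : ((-Complex.I : ℂ) : Sphere) ∉ upperDisc := fun h => by
      have := coe_mem_withInfty.1 h
      simp at this
      linarith
    rw [← Set.smul_mem_smul_set_iff (a := h), hu, hd, smul_mem_hset, coe_mem_hset, not_le] at h1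
    rwa [hβ] at h1
  have hw : 0 < (h 0 0 * star (h 0 1) - h 1 0 * star (h 1 1)).im := by
    rw [hform] at hp hm
    simp only [Complex.mul_re (_ - _), Complex.normSq_neg, Complex.normSq_I, Complex.I_re,
      Complex.I_im, Complex.neg_re, Complex.neg_im, star_one, mul_one] at hp hm
    linarith
  have hc : h 1 0 ≠ 0 := fun hc => by
    rw [OnePoint.smul_infty_eq_ite, if_pos hc] at hinf
    exact OnePoint.infty_ne_coe _ hinf
  rw [OnePoint.smul_infty_eq_ite, if_neg hc, OnePoint.coe_eq_coe, div_eq_iff hc] at hinf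
  rw [OnePoint.smul_some_eq_ite] at hzero hX
  have h0 : h 1 0 * ((0 : ℝ) : ℂ) + h 1 1 ≠ 0 := fun h0 => by
    rw [if_pos h0] at hzero
    exact OnePoint.infty_ne_coe _ hzero
  have h1 : h 1 0 * (X : ℂ) + h 1 1 ≠ 0 := fun h1 => by
    rw [if_pos h1] at hX
    exact OnePoint.infty_ne_coe _ hX
  rw [if_neg h0, OnePoint.coe_eq_coe, div_eq_iff h0, Complex.ofReal_zero, mul_zero, zero_add,
    mul_zero, zero_add] at hzero
  rw [if_neg h1] at hX
  rw [OnePoint.coe_eq_coe, div_eq_iff h1, hinf, hzero] at hX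
  rw [hinf, hzero] at hw
  have hn : star ζ₀ * ζ₀ = 1 := by
    rw [hζ₀, Complex.star_def, ← Complex.exp_conj, ← Complex.exp_add]
    simp
  set w := ζ₀ * h 1 0 * star (ζ₁ * h 1 1) - h 1 0 * star (h 1 1) with hwdef
  have hs : star w = star (h 1 0) * h 1 1 * (star ζ₀ * ζ₁ - 1) := by
    rw [hwdef]
    simp only [star_sub, star_mul', star_star]
    ring
  -- This is the equation for X cleared of denominators. By the chord formula both sides carry the
  -- phase `E`; dividing it out and taking real parts expresses Im w as X times positive factors.
  have key : star w * ζ₀ * (ζ₁ - ζ₂) =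
      X * (star (h 1 0) * h 1 0) * ((ζ₁ - ζ₀) * (ζ₂ - ζ₀)) := by
    rw [hs]
    linear_combination (star (h 1 0) * h 1 1 * ζ₁ * (ζ₁ - ζ₂)) * hn +
      star (h 1 0) * (ζ₁ - ζ₀) * hX
  set E := Complex.exp (Complex.I * (θ₀ + (θ₁ + θ₂) / 2 : ℝ)) with hE
  have e12 : ζ₀ * (ζ₁ - ζ₂) = -(2 * Complex.I * Real.sin ((θ₂ - θ₁) / 2)) * E := by
    rw [← neg_sub ζ₂, exp_I_sub_exp_I, hE, Complex.ofReal_add, mul_add, Complex.exp_add, add_comm θ₁]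
    ring
  have e20 : (ζ₁ - ζ₀) * (ζ₂ - ζ₀) =
      -4 * Real.sin ((θ₁ - θ₀) / 2) * Real.sin ((θ₂ - θ₀) / 2) * E := by
    have : (θ₀ + (θ₁ + θ₂) / 2 : ℝ) = (θ₁ + θ₀) / 2 + (θ₂ + θ₀) / 2 := by ring
    rw [exp_I_sub_exp_I, exp_I_sub_exp_I, hE, this, Complex.ofReal_add, mul_add, Complex.exp_add]
    linear_combination (4 * Real.sin ((θ₁ - θ₀) / 2) * Real.sin ((θ₂ - θ₀) / 2) *
      Complex.exp (Complex.I * ((θ₁ + θ₀) / 2 : ℝ)) *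
      Complex.exp (Complex.I * ((θ₂ + θ₀) / 2 : ℝ)) : ℂ) * Complex.I_mul_I
  have hE0 : E ≠ 0 := Complex.exp_ne_zero _
  have key2 : star w * Complex.I * Real.sin ((θ₂ - θ₁) / 2) =
      (2 * X * Complex.normSq (h 1 0) * Real.sin ((θ₁ - θ₀) / 2) * Real.sin ((θ₂ - θ₀) / 2) : ℝ) := by
    rw [mul_assoc, e12, e20] at key
    apply mul_right_cancel₀ hE0
    push_cast
    rw [Complex.normSq_eq_conj_mul_self, ← Complex.star_def]
    push_cast at key
    linear_combination (-1 / 2 : ℂ) * key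
  have key3 := congrArg Complex.re key2
  rw [Complex.ofReal_re, Complex.re_mul_ofReal, Complex.mul_I_re, Complex.star_def, Complex.conj_im,
    neg_neg] at key3
  have s1 : 0 < Real.sin ((θ₂ - θ₁) / 2) :=
    Real.sin_pos_of_pos_of_lt_pi (by linarith) (by linarith)
  have s2 : 0 < Real.sin ((θ₁ - θ₀) / 2) :=
    Real.sin_pos_of_pos_of_lt_pi (by linarith) (by linarith)
  have s3 : 0 < Real.sin ((θ₂ - θ₀) / 2) :=
    Real.sin_pos_of_pos_of_lt_pi (by linarith) (by linarith)
  have hnc := Complex.normSq_pos.2 hc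
  by_contra! hX0
  have l1 : 0 < w.im * Real.sin ((θ₂ - θ₁) / 2) := mul_pos hw s1
  have l2 : 0 ≤ -X * (Complex.normSq (h 1 0) * Real.sin ((θ₁ - θ₀) / 2) *
      Real.sin ((θ₂ - θ₀) / 2)) := mul_nonneg (by linarith) (by positivity)
  linarith

/-! ### Univalence -/

namespace Flower

variable {n : ℕ}

/-- In normalized position the petal before `c_0` is the unit disc centred at `2√3 u_0 - i`. -/
lemma IsNormalized.petal_neg_one {G : Flower n} {p : ZMod n → ℝ} (hG : G.IsNormalized)
    (h : G.HasLabel p) :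
    G.petal (-1) = euclDisc (((2 * √3 * p 0 : ℝ) : ℂ) - Complex.I) 1 := by
  have h0 := h 0
  rw [zero_sub, zero_add, hG.1, hG.2.1, hG.2.2] at h0
  rw [h0.eq_unitDisc, sub_sub_cancel]

/-- The labels of an un-branched flower are positive. -/
lemma Unbranched.label_pos {F : Flower n} {p : ZMod n → ℝ} (hn : 3 < n) (hF : F.Unbranched)
    (hp : F.HasLabel p) (k : ZMod n) : 0 < p k := by
  have : NeZero n := ⟨by omega⟩
  obtain ⟨g, hG⟩ := (hp.rotate k).exists_isNormalized
  have hL := (hp.rotate k).mobius g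
  obtain ⟨g', hC, θ, hθ, hper, htan⟩ := hF
  have hmono : StrictMono θ := strictMono_nat_of_lt_succ fun j => (hθ j).1
  set G := (F.rotate k).mobius g with hGdef
  have hX := hG.petal_neg_one hL
  have hcenter : g • F.center = upperDisc := hG.1
  have htouch : ∀ (i : ℕ) (t : Sphere), upperDisc ∩ G.petal i = {t} →
      (g' * g⁻¹) • t = ((Complex.exp (Complex.I * (θ (k.val + i) : ℂ)) : ℂ) : Sphere) := by
    intro i t ht
    have h1 := (htan (k.val + i)).smul (g * g'⁻¹)
    simp only [mul_smul, inv_smul_smul] at h1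
    rw [Nat.cast_add, ZMod.natCast_zmod_val, add_comm k, hcenter] at h1
    have h2 := h1.mem_inter (hcenter ▸ (F.isDisc_center.smul g).isClosed)
      ((F.isDisc_petal _).smul g).isClosed
    have h3 : g • g'⁻¹ • _ ∈ ({t} : Set Sphere) := ht ▸ h2
    rw [Set.mem_singleton_iff] at h3
    rw [← h3, mul_smul, inv_smul_smul, smul_inv_smul]
  have t0 := htouch 0 OnePoint.infty (by
    rw [Nat.cast_zero, hG.2.1]; exact upperDisc_inter_lowerDisc)
  have t1 := htouch 1 ((0 : ℝ) : ℂ) (by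
    have := upperDisc_inter_unitDisc 0
    rwa [Complex.ofReal_zero, zero_sub, ← hG.2.2, ← Nat.cast_one, ← Complex.ofReal_zero] at this)
  have t2 := htouch (n - 1) ((2 * √3 * shift k p 0 : ℝ) : ℂ) (by
    rw [Nat.cast_pred (by omega), CharP.cast_eq_zero, zero_sub, hX]
    exact upperDisc_inter_unitDisc _)
  -- Petals k, k+1 and k+n-1 touch `C` within one turn because θ(k+n) = θ(k) + 2π; wrapping exactly
  -- once is essential here.
  have hpos := pos_of_counterclockwise (h := g' * g⁻¹) (by
      rw [← hcenter, mul_smul, inv_smul_smul, hC]) (hmono (by omega)) (hmono (by omega))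
      (by
        rw [add_zero]
        have := hper k.val
        rw [Nat.cast_one, mul_one] at this
        rw [← this]
        exact hmono (by omega)) t0 t1 t2
  have h3 : 0 < 2 * √3 := by positivity
  have := pos_of_mul_pos_right hpos h3.le
  rwa [shift, zero_add] at this

/-! ### Necessity of (A) and (B) -/

lemma ne_zero_of_lt {m : ℕ} (h1 : 1 ≤ m) (h2 : m < n) : (m : ZMod n) ≠ 0 := by
  rw [Ne, ZMod.natCast_eq_zero_iff]
  exact Nat.not_dvd_of_pos_of_lt h1 h2

/-- The normalized layout of a flower with disjoint petals. -/
lemma exists_euclDisc_of_disjoint {G : Flower n} (hG : G.IsNormalized)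
    (hdisj : ∀ i j, i ≠ j → Disjoint (interior (G.petal i)) (interior (G.petal j))) {m : ℕ}
    (h1 : 1 ≤ m) (h2 : m < n) :
    ∃ (z : ℂ) (r : ℝ), 0 < r ∧ r ≤ 1 ∧ G.petal m = euclDisc z r := by
  refine (G.isDisc_petal m).exists_euclDisc ?_ ?_
  · obtain ⟨t, ht⟩ := G.tangent_center m
    rw [hG.1] at ht
    exact ht.2
  · have := hdisj 0 m (ne_zero_of_lt h1 h2).symm
    rwa [hG.2.1] at this

lemma inter_nonempty_of_tangent {D E : Set Sphere} (h : Tangent D E) (hD : IsDisc D)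
    (hE : IsDisc E) : (D ∩ E).Nonempty := by
  obtain ⟨t, ht⟩ := h
  exact ⟨t, ht.mem_inter hD.isClosed hE.isClosed⟩

/-- Starting from x ≤ 1 on `c_1`, each petal touches its predecessor and has diameter at most 2. -/
lemma re_le_of_disjoint {G : Flower n} (hG : G.IsNormalized)
    (hdisj : ∀ i j, i ≠ j → Disjoint (interior (G.petal i)) (interior (G.petal j))) (m : ℕ)
    (hm : m + 1 < n) (w : ℂ) (hw : (w : Sphere) ∈ G.petal (m + 1 : ℕ)) : w.re ≤ 2 * m + 1 := by
  induction m generalizing w with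
  | zero =>
    rw [zero_add, Nat.cast_one, hG.2.2, coe_mem_euclDisc] at hw
    have := (abs_le.1 ((Complex.abs_re_le_norm _).trans hw)).2
    simp at this ⊢
    linarith
  | succ m ih =>
    obtain ⟨z, r, -, hr, hz⟩ := exists_euclDisc_of_disjoint hG hdisj (m := m + 1 + 1) (by omega) hm
    have ht := G.tangent_succ (m + 1 : ℕ)
    rw [← Nat.cast_succ] at ht
    obtain ⟨x, hx, hx'⟩ := inter_nonempty_of_tangent ht (G.isDisc_petal _) (G.isDisc_petal _)
    rw [Nat.succ_eq_add_one, hz] at hx'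
    rw [hz, coe_mem_euclDisc] at hw
    obtain ⟨v, hv, rfl⟩ := hx'
    have h1 := ih (by omega) v hx
    rw [Metric.mem_closedBall, dist_eq_norm] at hv
    have h2 := (abs_le.1 ((Complex.abs_re_le_norm _).trans hw)).2
    have h3 := (abs_le.1 ((Complex.abs_re_le_norm _).trans hv)).1
    rw [Complex.sub_re] at h2 h3
    push_cast
    linarith

lemma Univalent.exists_normalized {F : Flower n} {p : ZMod n → ℝ} (hF : F.Univalent)
    (hp : F.HasLabel p) (k : ZMod n) : ∃ G : Flower n, G.IsNormalized ∧ G.HasLabel (shift k p) ∧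
      ∀ i j, i ≠ j → Disjoint (interior (G.petal i)) (interior (G.petal j)) := by
  obtain ⟨g, hG⟩ := (hp.rotate k).exists_isNormalized
  refine ⟨_, hG, (hp.rotate k).mobius g, fun i j hij => ?_⟩
  simp only [mobius, rotate, interior_smul]
  exact Set.disjoint_smul_set.2 (hF.2 _ _ (by simpa using hij))

lemma Univalent.conditionA {F : Flower n} {p : ZMod n → ℝ} (hn : 3 < n) (hF : F.Univalent)
    (hp : F.HasLabel p) : ConditionA p := by
  intro k
  have h3 : 0 < √3 := by positivity
  obtain ⟨G, hG, hL, hdisj⟩ := hF.exists_normalized hp k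
  have hX := hG.petal_neg_one hL
  rw [shift, zero_add] at hX
  have hpos := hF.1.label_pos hn hp k
  have e : ((n - 2 + 1 : ℕ) : ZMod n) = -1 := by
    rw [show n - 2 + 1 = n - 1 by omega, Nat.cast_pred (by omega), CharP.cast_eq_zero, zero_sub]
  constructor
  · rw [div_le_iff₀ h3]
    -- Otherwise √3 u - i, midway between the centres of `c_{-1}` and `c_1`, is interior to both.
    by_contra! hlt
    have h1 := hdisj (-1) 1 (by
      rw [← e, ne_eq, ← sub_eq_zero, Nat.cast_succ, add_sub_cancel_right]
      exact ne_zero_of_lt (by omega) (by omega))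
    rw [hX, hG.2.2, Set.disjoint_left] at h1
    have hs : |√3 * p k| < 1 := by
      rw [abs_of_pos (by positivity)]; linarith
    refine h1 (a := ((√3 * p k : ℝ) - Complex.I : ℂ)) (coe_mem_interior_euclDisc ?_)
      (coe_mem_interior_euclDisc ?_)
    · have : ((√3 * p k : ℝ) - Complex.I - (((2 * √3 * p k : ℝ) : ℂ) - Complex.I)) =
        ((-(√3 * p k) : ℝ) : ℂ) := by push_cast; ring
      rwa [this, Complex.norm_real, Real.norm_eq_abs, abs_neg]
    · rwa [sub_neg_eq_add, sub_add_cancel, Complex.norm_real, Real.norm_eq_abs]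
  -- The chain bound is applied to the rightmost point of `c_{n-1}`.
  · have h1 := re_le_of_disjoint hG hdisj (n - 2) (by omega)
      ((2 * √3 * p k + 1 : ℝ) - Complex.I : ℂ) (by
        rw [e, hX, coe_mem_euclDisc]
        have : (((2 * √3 * p k + 1 : ℝ) : ℂ) - Complex.I - (((2 * √3 * p k : ℝ) : ℂ) - Complex.I)) =
          1 := by push_cast; ring
        rw [this, norm_one])
    rw [Nat.cast_sub (by omega), Complex.sub_re, Complex.ofReal_re, Complex.I_re] at h1
    rw [le_div_iff₀ h3]
    push_cast at h1
    linarith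

lemma Univalent.conditionB {F : Flower n} {p : ZMod n → ℝ} (hF : F.Univalent)
    (hp : F.HasLabel p) : ConditionB p := by
  intro k j h2 hj
  obtain ⟨G, hG, hL, hdisj⟩ := hF.exists_normalized hp k
  obtain ⟨z, r, hr, hr1, hz⟩ := exists_euclDisc_of_disjoint hG hdisj (m := j) (by omega) (by omega)
  exact ⟨r, ⟨G, hG, hL, hr, z, hz⟩, hr1⟩

/-! ### Sufficiency -/

/-- Condition (B) says that no petal meets the petals which are not its neighbours. -/
lemma disjoint_of_conditionB {F : Flower n} {p : ZMod n → ℝ} (hn : 3 < n) (hp : F.HasLabel p)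
    (hB : ConditionB p) {i j : ZMod n} (hij : i ≠ j) :
    Disjoint (interior (F.petal i)) (interior (F.petal j)) := by
  have : NeZero n := ⟨by omega⟩
  set m := (j - i).val with hm
  have hj : j = m + i := by rw [hm, ZMod.natCast_zmod_val, sub_add_cancel]
  have hm0 : m ≠ 0 := fun h => hij (by rw [hj, h, Nat.cast_zero, zero_add])
  have hmn : m < n := ZMod.val_lt _
  rcases eq_or_ne m 1 with h1 | h1
  · obtain ⟨t, ht⟩ := F.tangent_succ i
    rw [hj, h1, Nat.cast_one, add_comm]
    exact ht.2
  rcases eq_or_ne m (n - 1) with h2 | h2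
  · obtain ⟨t, ht⟩ := F.tangent_succ j
    have : i = j + 1 := by
      rw [hj, h2, Nat.cast_pred (by omega), CharP.cast_eq_zero]; ring
    rw [this]
    exact ht.2.symm
  obtain ⟨r, ⟨G, hG, hL, hr, z, hz⟩, hr1⟩ := hB i m (by omega) (by omega)
  obtain ⟨g, hG'⟩ := (hp.rotate i).exists_isNormalized
  -- Uniqueness transfers the radius bound from the layout supplied by (B) to the normalized image
  -- of `F` itself.
  rw [hG.petal_eq hG' hL ((hp.rotate i).mobius g) m] at hz
  have ht := inter_nonempty_of_tangent (((F.rotate i).mobius g).tangent_center m)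
    ((F.rotate i).mobius g).isDisc_center (((F.rotate i).mobius g).isDisc_petal m)
  rw [hz, hG'.1] at ht
  have hd := disjoint_interior_lowerDisc hr1 ht
  rw [← hz, lowerDisc, ← hG'.2.1] at hd
  simp only [mobius, rotate, interior_smul, zero_add, ← hj] at hd
  exact Set.disjoint_smul_set.1 hd

end Flower

end CirclePacking

end

theorem theoremT (n : ℕ) (hn : 3 < n) (p : ZMod n → ℝ) (F : CirclePacking.Flower n)
    (hF : F.Unbranched) (hp : F.HasLabel p) :
    F.Univalent ↔ CirclePacking.ConditionA p ∧ CirclePacking.ConditionB p :=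
  ⟨fun h => ⟨h.conditionA hn hp, h.conditionB hp⟩,
    fun h => ⟨hF, fun _ _ hij => CirclePacking.Flower.disjoint_of_conditionB hn hp h.2 hij⟩⟩
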